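/- For sequences $x,y$, let $\mathrm{EDIT}(x,y)$ be the minimum number of insertions, deletions and substitutions of a symbol needed to transform $x$ into $y$. Juxtaposition and $\bigcirc$ denote concatenation, and $s^n$ is the symbol $s$ repeated $n$ times. Let $d\ge 0$ be an integer and put $l_0=1000d$, $l_1=(1000d)^2$, $l_2=(1000d)^3$, $l=d(4l_0+2l_1)$. For $x\in\{0,1\}$ define $$CG_1(x)=\begin{cases}0^{l_1}0^{l_0}1^{l_0}1^{l_0}1^{l_0}0^{l_1}& x=0\\ 0^{l_1}0^{l_0}0^{l_0}0^{l_0}1^{l_0}0^{l_1}& x=1\end{cases}\qquad CG_2(x)=\begin{cases}0^{l_1}0^{l_0}0^{l_0}1^{l_0}1^{l_0}0^{l_1}& x=0\\ 0^{l_1}1^{l_0}1^{l_0}1^{l_0}1^{l_0}0^{l_1}& x=1\end{cases}$$ and, for $d\ge1$, $g=0^{l_1/2-1}\,1\,0^{l_1/2}\,0^{l_0}1^{l_0}1^{l_0}1^{l_0}0^{l_1}$. For $a,b\in\{0,1\}^d$ let $$AG_1(a)=0^{l_2}\Big(\bigcirc_{i=1}^d g\Big)1^{l_2}\Big(\bigcirc_{i=1}^d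 CG_1(a_i)\Big)0^{l_2},\qquad AG_2(b)=1^{l_2}\Big(\bigcirc_{i=1}^d CG_2(b_i)\Big)1^{l_2}.$$ The lengths $|AG_1|,|AG_2|$ depend only on $d$; let $T=1000d\cdot\max(|AG_1|,|AG_2|)$ and $AG_k'(v)=2^T AG_k(v)2^T$ for $k\in\{1,2\}$. Let $f\in\{0,1\}^d$ be the all-ones vector, and let $$E_s=2l_2+l+d\,l_0,\qquad E_u=l+2l_2+d\,l_0+d.$$ Let $A,B\subseteq\{0,1\}^d$ with $|A|\le|B|$, each enumerated in an arbitrary order without repetition, and set $$P_1=\bigcirc_{a\in A}AG_1'(a),\qquad P_2=\Big(\bigcirc_{i=1}^{|A|-1}AG_2'(f)\Big)\Big(\bigcirc_{b\in B}AG_2'(b)\Big)\Big(\bigcirc_{i=1}^{|A|-1}AG_2'(f)\Big),$$ where the first and last blocks are empty if $A=\emptyset$. Let $P_2'=P_2$, $P_1'=3^{|P_2'|}\,P_1\,3^{|P_2'|}$ and $Y=2|P_2'|+|A|\cdot E_u$. Theorem. If there are no $a\in A$, $b\in B$ with $a\cdot b=\sum_{i=1}^d a_ib_i=0$, then $\mathrm{EDIT}(P_1',P_2')=Y$.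 If there are such $a$ and $b$, then $\mathrm{EDIT}(P_1',P_2')\le Y-(E_u-E_s)$. -/

import Mathlib

namespace EditHardness

/-! ### Edit distance -/

/-- `EditStep x y`: the sequence `y` arises from `x` by one insertion, deletion or substitution of
a symbol. -/
inductive EditStep {α : Type*} : List α → List α → Prop
  | insertion (u v : List α) (s : α) : EditStep (u ++ v) (u ++ s :: v)
  | deletion (u v : List α) (s : α) : EditStep (u ++ s :: v) (u ++ v)
  | substitution (u v : List α) (s s' : α) : EditStep (u ++ s :: v) (u ++ s' :: v)

/-- `EditsIn n x y`: the sequence `x` can be transformed into `y` by `n` successive edit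
operations. -/
inductive EditsIn {α : Type*} : ℕ → List α → List α → Prop
  | refl (x : List α) : EditsIn 0 x x
  | step {n : ℕ} {x y z : List α} : EditStep x y → EditsIn n y z → EditsIn (n + 1) x z

/-- The edit distance: the minimum number of symbol insertions, deletions and substitutions needed
to transform `x` into `y`. -/
noncomputable def EDIT {α : Type*} (x y : List α) : ℕ :=
  sInf {n : ℕ | EditsIn n x y}

theorem EditsIn.insert_all {α : Type*} (y : List α) : EditsIn y.length [] y := by
  suffices h : ∀ w u : List α, EditsIn w.length u (u ++ w) by simpa using h y []
  intro w
  induction w with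
  | nil => intro u; simpa using EditsIn.refl u
  | cons s w ih =>
    intro u
    have h1 : EditStep u (u ++ [s]) := by simpa using EditStep.insertion u [] s
    simpa using EditsIn.step h1 (ih (u ++ [s]))

/-- Some sequence of edit operations transforms `x` into `y`. -/
theorem exists_editsIn {α : Type*} (x y : List α) : ∃ n, EditsIn n x y := by
  induction x with
  | nil => exact ⟨_, EditsIn.insert_all y⟩
  | cons s x ih =>
    obtain ⟨n, hn⟩ := ih
    exact ⟨n + 1, EditsIn.step (EditStep.deletion [] x s) hn⟩

/-- The minimum in the definition of the edit distance is attained. -/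
theorem EDIT_isLeast {α : Type*} (x y : List α) : IsLeast {n : ℕ | EditsIn n x y} (EDIT x y) :=
  ⟨Nat.sInf_mem (exists_editsIn x y), fun _ h => Nat.sInf_le h⟩

/-! ### Parameters and gadgets -/

/-- Sequences over the alphabet `{0, 1, 2, 3}`. -/
abbrev Seq : Type := List (Fin 4)

/-- Vectors in `{0, 1}^d`. -/
abbrev Vec (d : ℕ) : Type := Fin d → Fin 2

/-- The dot product of two `0`/`1` vectors, over the natural numbers. -/
def dot {d : ℕ} (a b : Vec d) : ℕ := ∑ i, (a i : ℕ) * (b i : ℕ)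

/-- `run s n` is the sequence `s ^ n`, the symbol `s` repeated `n` times. -/
def run (s : Fin 4) (n : ℕ) : Seq := List.replicate n s

def l0 (d : ℕ) : ℕ := 1000 * d

def l1 (d : ℕ) : ℕ := (1000 * d) ^ 2

def l2 (d : ℕ) : ℕ := (1000 * d) ^ 3

/-- The common length of the sequences `L`, `R` and `D` below. -/
def l (d : ℕ) : ℕ := d * (4 * l0 d + 2 * l1 d)

/-- The first coordinate gadget. -/
def CG1 (d : ℕ) (x : Fin 2) : Seq :=
  if x = 0 then
    run 0 (l1 d) ++ run 0 (l0 d) ++ run 1 (l0 d) ++ run 1 (l0 d) ++ run 1 (l0 d) ++ run 0 (l1 d)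
  else
    run 0 (l1 d) ++ run 0 (l0 d) ++ run 0 (l0 d) ++ run 0 (l0 d) ++ run 1 (l0 d) ++ run 0 (l1 d)

/-- The second coordinate gadget. -/
def CG2 (d : ℕ) (x : Fin 2) : Seq :=
  if x = 0 then
    run 0 (l1 d) ++ run 0 (l0 d) ++ run 0 (l0 d) ++ run 1 (l0 d) ++ run 1 (l0 d) ++ run 0 (l1 d)
  else
    run 0 (l1 d) ++ run 1 (l0 d) ++ run 1 (l0 d) ++ run 1 (l0 d) ++ run 1 (l0 d) ++ run 0 (l1 d)

/-- The sequence `g`; it is only used when `d ≥ 1`, and then `l1 d / 2 - 1` and `l1 d / 2` are exact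
since `l1 d` is even and positive. -/
def g (d : ℕ) : Seq :=
  run 0 (l1 d / 2 - 1) ++ run 1 1 ++ run 0 (l1 d / 2) ++
    run 0 (l0 d) ++ run 1 (l0 d) ++ run 1 (l0 d) ++ run 1 (l0 d) ++ run 0 (l1 d)

/-- The concatenation `s 1 ∘ ⋯ ∘ s d`. -/
def concat {d : ℕ} (s : Fin d → Seq) : Seq := (List.ofFn s).flatten

/-- The first vector gadget, `Z₁ L V₀ R Z₂`. -/
def AG1 {d : ℕ} (a : Vec d) : Seq :=
  run 0 (l2 d) ++ concat (fun _ : Fin d => g d) ++ run 1 (l2 d) ++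
    concat (fun i => CG1 d (a i)) ++ run 0 (l2 d)

/-- The second vector gadget, `V₁ D V₂`. -/
def AG2 {d : ℕ} (b : Vec d) : Seq :=
  run 1 (l2 d) ++ concat (fun i => CG2 d (b i)) ++ run 1 (l2 d)

def Es (d : ℕ) : ℕ := 2 * l2 d + l d + d * l0 d

def Eu (d : ℕ) : ℕ := l d + 2 * l2 d + d * l0 d + d

/-- The vector consisting only of `1`s. -/
def f (d : ℕ) : Vec d := fun _ => 1

/-- The larger of the lengths of the two vector gadgets. These lengths do not depend on the vector,
see `length_AG1` and `length_AG2`. -/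
def t (d : ℕ) : ℕ := max (AG1 (f d)).length (AG2 (f d)).length

def T (d : ℕ) : ℕ := 1000 * d * t d

/-- `2^T AG₁(a) 2^T` -/
def AG1' {d : ℕ} (a : Vec d) : Seq := run 2 (T d) ++ AG1 a ++ run 2 (T d)

/-- `2^T AG₂(b) 2^T` -/
def AG2' {d : ℕ} (b : Vec d) : Seq := run 2 (T d) ++ AG2 b ++ run 2 (T d)

theorem length_concat {d : ℕ} (s : Fin d → Seq) (m : ℕ) (h : ∀ i, (s i).length = m) :
    (concat s).length = d * m := by
  simp [concat, List.length_flatten, List.map_ofFn, Function.comp_def, h]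

theorem length_g {d : ℕ} (hd : 0 < d) : (g d).length = 4 * l0 d + 2 * l1 d := by
  have h : l1 d = 2 * (500000 * d ^ 2) := by unfold l1; ring
  have h' : 0 < d ^ 2 := by positivity
  simp only [g, run, List.length_append, List.length_replicate]
  omega

/-- The length of the first vector gadget depends only on `d`. -/
theorem length_AG1 {d : ℕ} (a : Vec d) : (AG1 a).length = 3 * l2 d + 2 * l d := by
  have h1 : (concat (fun _ : Fin d => g d)).length = l d :=
    length_concat _ _ fun i => length_g (Fin.pos i)
  have h2 : (concat (fun i => CG1 d (a i))).length = l d :=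
    length_concat _ _ fun i => by unfold CG1 run; split_ifs <;> simp <;> omega
  simp only [AG1, run, List.length_append, List.length_replicate, h1, h2]
  omega

/-- The length of the second vector gadget depends only on `d`. -/
theorem length_AG2 {d : ℕ} (b : Vec d) : (AG2 b).length = 2 * l2 d + l d := by
  have h2 : (concat (fun i => CG2 d (b i))).length = l d :=
    length_concat _ _ fun i => by unfold CG2 run; split_ifs <;> simp <;> omega
  simp only [AG2, run, List.length_append, List.length_replicate, h2]
  omega

/-! ### The reduction

The sets of vectors enter through lists `as`, `bs` that enumerate their elements. -/

/-- The concatenation of `AG₁'(a)` over the vectors `a` of the list. -/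
def P1 {d : ℕ} (as : List (Vec d)) : Seq := (as.map AG1').flatten

/-- The concatenation of `AG₂'(b)` over the vectors `b` of `bs`, between two blocks of `|as| - 1`
copies of `AG₂'(f)` (no copies if `as` is empty). -/
def P2 {d : ℕ} (as bs : List (Vec d)) : Seq :=
  (List.replicate (as.length - 1) (AG2' (f d))).flatten ++
    (bs.map AG2').flatten ++
    (List.replicate (as.length - 1) (AG2' (f d))).flatten

def P2' {d : ℕ} (as bs : List (Vec d)) : Seq := P2 as bs

/-- `3^{|P₂'|} P₁ 3^{|P₂'|}` -/
def P1' {d : ℕ} (as bs : List (Vec d)) : Seq :=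
  run 3 (P2' as bs).length ++ P1 as ++ run 3 (P2' as bs).length

end EditHardness

/-!
The distance of two vector gadgets decides the theorem: `EDIT (AG1 a) (AG2 b) ≤ Es d` if `a` and
`b` are orthogonal (`EDIT_AG_le_Es`), and `EDIT (AG1 a) (AG2 b)` equals `Eu d = Es d + d` otherwise
(`EDIT_AG_le_Eu`, `Eu_le_EDIT_AG`).

From vector gadgets to sets: every `3` of `P₁'` costs one step, and the runs of `3`s are long
enough to be substituted by whatever part of `P₂` is not aligned with `P₁`. Thus `EDIT P₁' P₂'` is
`2 |P₂'|` plus the distance of `P₁` to the closest contiguous part of `P₂` (`EDIT_P1'_le`,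
`exists_infix_le_EDIT_P1'`). The gadgets of `P₁` can be aligned with any `|A|` consecutive gadgets
of `P₂`, and the gadgets of `f` make room for placing a given `a` opposite a given `b`; this gives
both upper bounds. For the lower bound, the contiguous part is cut into one piece per gadget of
`P₁`, and each piece costs at least `Eu d` (`Eu_le_EDIT_AG1'_infix`): the long runs of `2`s prevent
a piece from meeting two gadgets of `P₂`, and a piece that meets only part of a gadget of `P₂` pays
for the missing symbols when its runs of `2`s are formed. Here no gadget of `P₂` is orthogonal to
one of `P₁`: a vector orthogonal to `f` is zero, hence orthogonal to the elements of `B`.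

The lower bound for two vector gadgets uses only three facts on the edit distance: an optimal
transformation into (or from) a concatenation can be cut into transformations of its parts
(`exists_split_left`, `exists_split_right`), the length and the number of symbols of one kind are
`1`-Lipschitz, and distances are subadditive under concatenation. Cutting `AG1 a` into parts that
go into `V₁`, `D` and `V₂` leaves, after comparing lengths and numbers of `1`s, the cases in which
`D` comes from around `L` or from around `R` (`le_EDIT_vector_gadgets`). There the coordinate
gadgets cannot be shifted by more than their padding with `0`s, so the cost is bounded gadget by
gadget (`sum_le_EDIT_padded`): `CG₁(x)` and `CG₂(y)` are separated by their numbers of `1`s, and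
`g` and `CG₂(y)` by their numbers of `1`s together with the isolated `1` in `g`.
-/

namespace EditHardness

/-! ### General properties of the edit distance -/

theorem EditStep.symm {α : Type*} {x y : List α} (h : EditStep x y) : EditStep y x := by
  cases h with
  | insertion u v s => exact .deletion u v s
  | deletion u v s => exact .insertion u v s
  | substitution u v s s' => exact .substitution u v s' s

theorem EditStep.append_right {α : Type*} {x y : List α} (h : EditStep x y) (w : List α) :
    EditStep (x ++ w) (y ++ w) := by
  cases h with
  | insertion u v s => simpa using EditStep.insertion u (v ++ w) s
  | deletion u v s => simpa using EditStep.deletion u (v ++ w) s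
  | substitution u v s s' => simpa using EditStep.substitution u (v ++ w) s s'

theorem EditStep.append_left {α : Type*} {x y : List α} (h : EditStep x y) (w : List α) :
    EditStep (w ++ x) (w ++ y) := by
  cases h with
  | insertion u v s => simpa using EditStep.insertion (w ++ u) v s
  | deletion u v s => simpa using EditStep.deletion (w ++ u) v s
  | substitution u v s s' => simpa using EditStep.substitution (w ++ u) v s s'

theorem EditsIn.trans {α : Type*} {m n : ℕ} {x y z : List α} (h : EditsIn m x y)
    (h' : EditsIn n y z) : EditsIn (m + n) x z := by
  induction h with
  | refl x => simpa using h'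
  | step hs _ ih =>
    rw [Nat.add_right_comm]
    exact .step hs (ih h')

theorem EditsIn.symm {α : Type*} {n : ℕ} {x y : List α} (h : EditsIn n x y) : EditsIn n y x := by
  induction h with
  | refl x => exact .refl x
  | step hs _ ih => exact ih.trans (.step hs.symm (.refl _))

theorem EditsIn.append_right {α : Type*} {n : ℕ} {x y : List α} (h : EditsIn n x y) (w : List α) :
    EditsIn n (x ++ w) (y ++ w) := by
  induction h with
  | refl x => exact .refl _
  | step hs _ ih => exact .step (hs.append_right w) ih

theorem EditsIn.append_left {α : Type*} {n : ℕ} {x y : List α} (h : EditsIn n x y) (w : List α) :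
    EditsIn n (w ++ x) (w ++ y) := by
  induction h with
  | refl x => exact .refl _
  | step hs _ ih => exact .step (hs.append_left w) ih

theorem editsIn_EDIT {α : Type*} (x y : List α) : EditsIn (EDIT x y) x y :=
  (EDIT_isLeast x y).1

theorem EditsIn.EDIT_le {α : Type*} {n : ℕ} {x y : List α} (h : EditsIn n x y) : EDIT x y ≤ n :=
  (EDIT_isLeast x y).2 h

theorem EDIT_comm {α : Type*} (x y : List α) : EDIT x y = EDIT y x :=
  le_antisymm (editsIn_EDIT y x).symm.EDIT_le (editsIn_EDIT x y).symm.EDIT_le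

@[simp] theorem EDIT_self {α : Type*} (x : List α) : EDIT x x = 0 :=
  Nat.le_zero.1 (EditsIn.refl x).EDIT_le

theorem EDIT_append_le {α : Type*} (x₁ x₂ y₁ y₂ : List α) :
    EDIT (x₁ ++ x₂) (y₁ ++ y₂) ≤ EDIT x₁ y₁ + EDIT x₂ y₂ :=
  (((editsIn_EDIT x₁ y₁).append_right x₂).trans ((editsIn_EDIT x₂ y₂).append_left y₁)).EDIT_le

theorem EDIT_nil_left_le {α : Type*} (y : List α) : EDIT [] y ≤ y.length :=
  (EditsIn.insert_all y).EDIT_le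

theorem EDIT_nil_right_le {α : Type*} (x : List α) : EDIT x [] ≤ x.length :=
  EDIT_comm x [] ▸ EDIT_nil_left_le x

theorem EDIT_le_max_length {α : Type*} (x y : List α) : EDIT x y ≤ max x.length y.length := by
  induction x generalizing y with
  | nil => simpa using EDIT_nil_left_le y
  | cons a x ih =>
    cases y with
    | nil => simpa using EDIT_nil_right_le (a :: x)
    | cons b y =>
      have h1 : EDIT [a] [b] ≤ 1 :=
        (EditsIn.step (EditStep.substitution [] [] a b) (.refl _)).EDIT_le
      have h2 := EDIT_append_le [a] x [b] y
      have h3 := ih y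
      simp only [List.cons_append, List.nil_append] at h2
      simp only [List.length_cons]
      omega

theorem EDIT_flatten_map_le {α ι : Type*} (s s' : ι → List α) (is : List ι) :
    EDIT (is.map s).flatten (is.map s').flatten ≤ (is.map fun i => EDIT (s i) (s' i)).sum := by
  induction is with
  | nil => simp
  | cons i is ih =>
    have h := EDIT_append_le (s i) (is.map s).flatten (s' i) (is.map s').flatten
    simp only [List.map_cons, List.flatten_cons, List.sum_cons]
    omega

/-- A single edit step into a concatenation takes place in one of the two parts. -/
theorem EditStep.split {α : Type*} {x z₁ z₂ : List α} (h : EditStep x (z₁ ++ z₂)) :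
    (∃ x₁, x = x₁ ++ z₂ ∧ EditStep x₁ z₁) ∨ ∃ x₂, x = z₁ ++ x₂ ∧ EditStep x₂ z₂ := by
  generalize hz : z₁ ++ z₂ = z at h
  cases h with
  | insertion u v s =>
    rcases List.append_eq_append_iff.1 hz with ⟨a, rfl, rfl⟩ | ⟨a, rfl, ha⟩
    · exact .inr ⟨a ++ v, by simp, .insertion a v s⟩
    · rcases List.cons_eq_append_iff.1 ha with ⟨rfl, rfl⟩ | ⟨a', rfl, rfl⟩
      · exact .inr ⟨v, by simp, .insertion [] v s⟩
      · exact .inl ⟨u ++ a', by simp, .insertion u a' s⟩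
  | deletion u v s =>
    rcases List.append_eq_append_iff.1 hz with ⟨a, rfl, rfl⟩ | ⟨a, rfl, rfl⟩
    · exact .inr ⟨a ++ s :: v, by simp, .deletion a v s⟩
    · exact .inl ⟨u ++ s :: a, by simp, .deletion u a s⟩
  | substitution u v s s' =>
    rcases List.append_eq_append_iff.1 hz with ⟨a, rfl, rfl⟩ | ⟨a, rfl, ha⟩
    · exact .inr ⟨a ++ s :: v, by simp, .substitution a v s s'⟩
    · rcases List.cons_eq_append_iff.1 ha with ⟨rfl, rfl⟩ | ⟨a', rfl, rfl⟩
      · exact .inr ⟨s :: v, by simp, .substitution [] v s s'⟩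
      · exact .inl ⟨u ++ s :: a', by simp, .substitution u a' s s'⟩

theorem EditsIn.split {α : Type*} {n : ℕ} {x z₁ z₂ : List α} (h : EditsIn n x (z₁ ++ z₂)) :
    ∃ x₁ x₂ n₁ n₂, x = x₁ ++ x₂ ∧ n = n₁ + n₂ ∧ EditsIn n₁ x₁ z₁ ∧ EditsIn n₂ x₂ z₂ := by
  generalize hz : z₁ ++ z₂ = z at h
  induction h with
  | refl x => exact ⟨z₁, z₂, 0, 0, hz.symm, rfl, .refl _, .refl _⟩
  | @step n _ _ _ hs _ ih =>
    obtain ⟨x₁, x₂, n₁, n₂, rfl, rfl, h1, h2⟩ := ih hz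
    rcases hs.split with ⟨x', rfl, h⟩ | ⟨x', rfl, h⟩
    · exact ⟨x', x₂, n₁ + 1, n₂, rfl, by omega, .step h h1, h2⟩
    · exact ⟨x₁, x', n₁, n₂ + 1, rfl, by omega, h1, .step h h2⟩

/-- An optimal transformation into a concatenation splits into transformations into its two
parts. -/
theorem exists_split_left {α : Type*} (x z₁ z₂ : List α) :
    ∃ x₁ x₂, x = x₁ ++ x₂ ∧ EDIT x₁ z₁ + EDIT x₂ z₂ ≤ EDIT x (z₁ ++ z₂) := by
  obtain ⟨x₁, x₂, n₁, n₂, hx, hn, h1, h2⟩ := (editsIn_EDIT x (z₁ ++ z₂)).split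
  exact ⟨x₁, x₂, hx, hn ▸ Nat.add_le_add h1.EDIT_le h2.EDIT_le⟩

theorem exists_split_right {α : Type*} (x₁ x₂ z : List α) :
    ∃ z₁ z₂, z = z₁ ++ z₂ ∧ EDIT x₁ z₁ + EDIT x₂ z₂ ≤ EDIT (x₁ ++ x₂) z := by
  obtain ⟨z₁, z₂, hz, h⟩ := exists_split_left z x₁ x₂
  refine ⟨z₁, z₂, hz, ?_⟩
  rwa [EDIT_comm x₁, EDIT_comm x₂, EDIT_comm (x₁ ++ x₂)]

/-- A function that every edit step increases by at most one is `1`-Lipschitz with respect to the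
edit distance. -/
theorem le_add_EDIT {α : Type*} (φ : List α → ℕ)
    (hφ : ∀ x y, EditStep x y → φ y ≤ φ x + 1) (x y : List α) : φ y ≤ φ x + EDIT x y := by
  have h := editsIn_EDIT x y
  generalize EDIT x y = n at h
  induction h with
  | refl x => omega
  | step hs _ ih => have := hφ _ _ hs; omega

theorem countP_le_add_EDIT {α : Type*} (p : α → Bool) (x y : List α) :
    y.countP p ≤ x.countP p + EDIT x y := by
  refine le_add_EDIT _ (fun x y h => ?_) x y
  cases h <;> simp only [List.countP_append, List.countP_cons] <;> split_ifs <;> omega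

theorem count_le_add_EDIT {α : Type*} [DecidableEq α] (s : α) (x y : List α) :
    y.count s ≤ x.count s + EDIT x y :=
  countP_le_add_EDIT _ x y

theorem count_le_add_EDIT' {α : Type*} [DecidableEq α] (s : α) (x y : List α) :
    x.count s ≤ y.count s + EDIT x y :=
  EDIT_comm x y ▸ count_le_add_EDIT s y x

theorem length_le_add_EDIT {α : Type*} (x y : List α) : y.length ≤ x.length + EDIT x y := by
  simpa [List.countP_true] using countP_le_add_EDIT (fun _ => true) x y

theorem length_le_add_EDIT' {α : Type*} (x y : List α) : x.length ≤ y.length + EDIT x y :=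
  EDIT_comm x y ▸ length_le_add_EDIT y x

/-- The number of symbols different from `s` changes by at most one in each edit step. -/
theorem length_sub_count_le {α : Type*} [DecidableEq α] (s : α) (x y : List α) :
    y.length + x.count s ≤ x.length + y.count s + EDIT x y := by
  have h := countP_le_add_EDIT (fun a => ¬ (a == s) = true) x y
  have hx := List.length_eq_countP_add_countP (fun a => a == s) (l := x)
  have hy := List.length_eq_countP_add_countP (fun a => a == s) (l := y)
  simp only [List.count] at *
  omega

theorem length_sub_count_le' {α : Type*} [DecidableEq α] (s : α) (x y : List α) :
    x.length + y.count s ≤ y.length + x.count s + EDIT x y :=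
  EDIT_comm x y ▸ length_sub_count_le s y x

/-- Erasing all symbols outside a given set from both sequences does not increase the edit
distance. -/
theorem EDIT_filter_le {α : Type*} (p : α → Bool) (x y : List α) :
    EDIT (x.filter p) (y.filter p) ≤ EDIT x y := by
  have h := editsIn_EDIT x y
  generalize EDIT x y = n at h
  suffices ∃ m ≤ n, EditsIn m (x.filter p) (y.filter p) by
    obtain ⟨m, hm, h⟩ := this
    exact h.EDIT_le.trans hm
  induction h with
  | refl x => exact ⟨0, le_rfl, .refl _⟩
  | step hs _ ih =>
    obtain ⟨m, hm, ih⟩ := ih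
    cases hs with
    | insertion u v s =>
      by_cases hp : p s
      · refine ⟨m + 1, by omega, .step ?_ ih⟩
        simpa [List.filter_cons, hp] using EditStep.insertion (u.filter p) (v.filter p) s
      · exact ⟨m, by omega, by simpa [List.filter_cons, hp] using ih⟩
    | deletion u v s =>
      by_cases hp : p s
      · refine ⟨m + 1, by omega, .step ?_ ih⟩
        simpa [List.filter_cons, hp] using EditStep.deletion (u.filter p) (v.filter p) s
      · exact ⟨m, by omega, by simpa [List.filter_cons, hp] using ih⟩
    | substitution u v s s' =>
      by_cases hp : p s <;> by_cases hp' : p s'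
      · refine ⟨m + 1, by omega, .step ?_ ih⟩
        simpa [List.filter_cons, hp, hp'] using
          EditStep.substitution (u.filter p) (v.filter p) s s'
      · refine ⟨m + 1, by omega, .step ?_ ih⟩
        simpa [List.filter_cons, hp, hp'] using EditStep.deletion (u.filter p) (v.filter p) s
      · refine ⟨m + 1, by omega, .step ?_ ih⟩
        simpa [List.filter_cons, hp, hp'] using EditStep.insertion (u.filter p) (v.filter p) s'
      · exact ⟨m, by omega, by simpa [List.filter_cons, hp, hp'] using ih⟩

theorem EDIT_append_left_le {α : Type*} (w x y : List α) : EDIT (w ++ x) (w ++ y) ≤ EDIT x y := by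
  simpa using EDIT_append_le w x w y

theorem EDIT_append_right_le {α : Type*} (w x y : List α) :
    EDIT (x ++ w) (y ++ w) ≤ EDIT x y := by
  simpa using EDIT_append_le x w y w

/-! ### Runs of a symbol -/

@[simp] theorem length_run (s : Fin 4) (n : ℕ) : (run s n).length = n := List.length_replicate ..

@[simp] theorem count_run (a s : Fin 4) (n : ℕ) : (run s n).count a = if s = a then n else 0 := by
  simp [run, List.count_replicate]

theorem run_add (s : Fin 4) (m n : ℕ) : run s (m + n) = run s m ++ run s n :=
  List.replicate_add ..

theorem run_append_run (s : Fin 4) (m n : ℕ) : run s m ++ run s n = run s (m + n) :=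
  (run_add s m n).symm

theorem eq_run_of_append_eq_run {s : Fin 4} {n : ℕ} {x y : Seq} (h : x ++ y = run s n) :
    x = run s x.length ∧ y = run s y.length ∧ x.length + y.length = n := by
  obtain ⟨hn, hx, hy⟩ := List.append_eq_replicate_iff.1 h
  exact ⟨hx, hy, hn⟩

/-! ### Sequences of padded blocks -/

/-- Suppose that `W i`, between any two runs of `0`s, is at distance at least `c i` from `Y i`. If a
sequence starting with `0^s` in which the `W i` are separated by `0^(2h)` can be transformed into
`∘ Y i` with `e ≤ h - |s - h|` steps, then `∑ c i ≤ e`: since `|Y i| = |W i| + 2h`, so few steps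
cannot shift a block by more than its padding, so the part that goes into `Y i` is `W i` between
runs of `0`s. The final runs `0^k` and `0^h` make the last block look like the others. -/
theorem sum_le_EDIT_padded {ι : Type*} (h k m : ℕ) (W Y : ι → Seq) (c : ι → ℕ)
    (hW : ∀ i, (W i).length + 2 * h = m) (hY : ∀ i, (Y i).length = m)
    (hc : ∀ i p q, c i ≤ EDIT (run 0 p ++ W i ++ run 0 q) (Y i)) (is : List ι) (s e : ℕ)
    (he : EDIT (run 0 s ++ (is.map fun i => W i ++ run 0 (2 * h)).flatten ++ run 0 k)
      ((is.map Y).flatten ++ run 0 h) ≤ e)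
    (hs : e ≤ s) (hs' : s + e ≤ 2 * h) : (is.map c).sum ≤ e := by
  induction is generalizing s e with
  | nil => simp
  | cons i is ih =>
    simp only [List.map_cons, List.flatten_cons, List.sum_cons] at he ⊢
    set tail := (is.map fun i => W i ++ run 0 (2 * h)).flatten with htail
    rw [List.append_assoc (Y i)] at he
    obtain ⟨x₁, x₂, hx, hx'⟩ := exists_split_left
      (run 0 s ++ (W i ++ run 0 (2 * h) ++ tail) ++ run 0 k) (Y i)
      ((is.map Y).flatten ++ run 0 h)
    have h1 := length_le_add_EDIT x₁ (Y i)
    have h2 := length_le_add_EDIT' x₁ (Y i)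
    have hWi := hW i
    rw [hY i] at h1 h2
    -- The cut after the part for `Y i` lies `q` symbols behind `W i`, and `0 ≤ q ≤ 2h`; the
    -- remaining problem has the offset `s' = 2h - q`, which differs from `s` by at most the cost
    -- spent on `Y i`.
    obtain ⟨q, hq⟩ : ∃ q, x₁.length = s + (W i).length + q :=
      ⟨x₁.length - s - (W i).length, by omega⟩
    obtain ⟨s', hs''⟩ : ∃ s', 2 * h = q + s' := ⟨2 * h - q, by omega⟩
    have hx2 : (run 0 s ++ W i ++ run 0 q) ++ (run 0 s' ++ tail ++ run 0 k) = x₁ ++ x₂ := by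
      rw [← hx, hs'', run_add]
      simp only [List.append_assoc]
    obtain ⟨rfl, rfl⟩ := List.append_inj hx2 (by simp [hq, add_assoc])
    have h3 := hc i s q
    have h4 := ih s' (e - EDIT (run 0 s ++ W i ++ run 0 q) (Y i)) (by omega) (by omega) (by omega)
    omega

theorem flatten_padded {ι : Type*} (h : ℕ) (W : ι → Seq) (is : List ι) :
    (is.map fun i => run 0 h ++ W i ++ run 0 h).flatten ++ run 0 h =
      run 0 h ++ (is.map fun i => W i ++ run 0 (2 * h)).flatten := by
  induction is with
  | nil => simp
  | cons i is ih =>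
    simp only [List.map_cons, List.flatten_cons]
    rw [List.append_assoc, ih]
    simp only [List.append_assoc, two_mul, run_add]

theorem length_flatten_map {ι : Type*} (m : ℕ) (Y : ι → Seq) (hY : ∀ i, (Y i).length = m)
    (is : List ι) : (is.map Y).flatten.length = is.length * m := by
  induction is with
  | nil => simp
  | cons i is ih =>
    simp only [List.map_cons, List.flatten_cons, List.length_append, ih, hY, List.length_cons]
    ring

/-- The total cost of aligning blocks padded by `0^h` is bounded below blockwise, also when the
sequence of blocks is surrounded by further `0`s. -/
theorem le_EDIT_blocks {ι : Type*} (h m C : ℕ) (X W Y : ι → Seq) (c : ι → ℕ)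
    (hX : ∀ i, X i = run 0 h ++ W i ++ run 0 h)
    (hXm : ∀ i, (X i).length = m) (hY : ∀ i, (Y i).length = m)
    (hc : ∀ i p q, c i ≤ EDIT (run 0 p ++ W i ++ run 0 q) (Y i)) (is : List ι)
    (hC : C ≤ (is.map c).sum) (hCh : 2 * C ≤ h) (k k' : ℕ) :
    C ≤ EDIT (run 0 k ++ (is.map X).flatten ++ run 0 k') (is.map Y).flatten := by
  by_contra! hlt
  set e := EDIT (run 0 k ++ (is.map X).flatten ++ run 0 k') (is.map Y).flatten with he
  have hlen := length_le_add_EDIT' (run 0 k ++ (is.map X).flatten ++ run 0 k') (is.map Y).flatten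
  simp only [List.length_append, length_run, length_flatten_map m X hXm,
    length_flatten_map m Y hY] at hlen
  have hW : ∀ i, (W i).length + 2 * h = m := fun i => by
    have := hXm i
    rw [hX i] at this
    simp only [List.length_append, length_run] at this
    omega
  have h1 : (run 0 k ++ (is.map X).flatten ++ run 0 k') ++ run 0 h =
      run 0 (k + h) ++ (is.map fun i => W i ++ run 0 (2 * h)).flatten ++ run 0 k' := by
    rw [List.append_assoc, run_append_run, add_comm k' h, run_add, funext hX, run_add,
      List.append_assoc _ (run 0 h) _, ← flatten_padded]
    simp only [List.append_assoc]
  have h2 := sum_le_EDIT_padded h k' m W Y c hW hY hc is (k + h) e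
    (by rw [← h1]; exact EDIT_append_right_le ..) (by omega) (by omega)
  omega

/-- Additional `1`s in front of a sequence are useless for reaching a target that starts with many
`0`s. -/
theorem add_le_EDIT_run_append (C j q : ℕ) (x y : Seq)
    (hC : ∀ i, C ≤ EDIT (run 0 i ++ x) (run 0 q ++ y)) (hj : j + C ≤ q) :
    j + C ≤ EDIT (run 1 j ++ x) (run 0 q ++ y) := by
  obtain ⟨y₁, y₂, hy, hle⟩ := exists_split_right (run 1 j) x (run 0 q ++ y)
  rcases List.append_eq_append_iff.1 hy with ⟨a, rfl, rfl⟩ | ⟨a, ha, rfl⟩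
  · have h1 := count_le_add_EDIT (0 : Fin 4) (run 1 j) (run 0 q ++ a)
    simp [List.count_append] at h1
    omega
  · obtain ⟨h1, -, -⟩ := eq_run_of_append_eq_run ha.symm
    have h2 := EDIT_append_left_le y₁ x (a ++ y)
    rw [← List.append_assoc, ← ha] at h2
    have h3 := hC y₁.length
    rw [← h1] at h3
    have h4 := count_le_add_EDIT' (1 : Fin 4) (run 1 j) y₁
    rw [h1] at h4
    simp only [count_run, if_true, zero_ne_one, if_false] at h4
    rw [← h1] at h4
    omega

theorem add_le_EDIT_append_run (C j q : ℕ) (x y : Seq)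
    (hC : ∀ i, C ≤ EDIT (x ++ run 0 i) (y ++ run 0 q)) (hj : j + C ≤ q) :
    j + C ≤ EDIT (x ++ run 1 j) (y ++ run 0 q) := by
  obtain ⟨y₁, y₂, hy, hle⟩ := exists_split_right x (run 1 j) (y ++ run 0 q)
  rcases List.append_eq_append_iff.1 hy with ⟨a, rfl, ha⟩ | ⟨a, rfl, rfl⟩
  · obtain ⟨-, h1, -⟩ := eq_run_of_append_eq_run ha.symm
    have h2 := EDIT_append_right_le y₂ x (y ++ a)
    rw [List.append_assoc, ← ha] at h2
    have h3 := hC y₂.length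
    rw [← h1] at h3
    have h4 := count_le_add_EDIT' (1 : Fin 4) (run 1 j) y₂
    rw [h1] at h4
    simp only [count_run, if_true, zero_ne_one, if_false] at h4
    rw [← h1] at h4
    omega
  · have h1 := count_le_add_EDIT (0 : Fin 4) (run 1 j) (a ++ run 0 q)
    simp [List.count_append] at h1
    omega

/-! ### The coordinate gadgets -/

/-- The length of the shortest run of `0`s at the ends of `g` and `CG₁`. -/
def pad (d : ℕ) : ℕ := l1 d / 2 - 1

/-- `g` without `pad d` of the `0`s at either end. -/
def gCore (d : ℕ) : Seq :=
  run 1 1 ++ run 0 (l1 d / 2 + l0 d) ++ run 1 (3 * l0 d) ++ run 0 (l1 d - pad d)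

/-- `CG₁` without `pad d` of the `0`s at either end. -/
def CG1Core (d : ℕ) (x : Fin 2) : Seq :=
  if x = 0 then run 0 (l1 d - pad d + l0 d) ++ run 1 (3 * l0 d) ++ run 0 (l1 d - pad d)
  else run 0 (l1 d - pad d + 3 * l0 d) ++ run 1 (l0 d) ++ run 0 (l1 d - pad d)

theorem pad_le (d : ℕ) : pad d ≤ l1 d := by unfold pad; omega

theorem run_l1_left (d : ℕ) : run 0 (l1 d) = run 0 (pad d) ++ run 0 (l1 d - pad d) := by
  rw [run_append_run, Nat.add_sub_cancel' (pad_le d)]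

theorem run_l1_right (d : ℕ) : run 0 (l1 d) = run 0 (l1 d - pad d) ++ run 0 (pad d) := by
  rw [run_append_run, Nat.sub_add_cancel (pad_le d)]

theorem run_three_mul (s : Fin 4) (n : ℕ) : run s (3 * n) = run s n ++ run s n ++ run s n := by
  rw [run_append_run, run_append_run]
  congr 1
  omega

theorem g_eq (d : ℕ) : g d = run 0 (pad d) ++ gCore d ++ run 0 (pad d) := by
  unfold g gCore
  rw [run_l1_right d, run_three_mul, run_add]
  simp only [List.append_assoc, pad]

theorem CG1_eq (d : ℕ) (x : Fin 2) :
    CG1 d x = run 0 (pad d) ++ CG1Core d x ++ run 0 (pad d) := by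
  have h : run 0 (l1 d) ++ run 0 (l0 d) = run 0 (pad d) ++ run 0 (l1 d - pad d + l0 d) := by
    rw [run_l1_left d, run_add]
    simp only [List.append_assoc]
  have h' : run 0 (l1 d) ++ run 0 (l0 d) ++ run 0 (l0 d) ++ run 0 (l0 d) =
      run 0 (pad d) ++ run 0 (l1 d - pad d + 3 * l0 d) := by
    rw [run_l1_left d, run_add, run_three_mul]
    simp only [List.append_assoc]
  unfold CG1 CG1Core
  split_ifs
  · rw [h, run_three_mul, run_l1_right d]
    simp only [List.append_assoc]
  · rw [h', run_l1_right d]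
    simp only [List.append_assoc]

theorem length_CG1 (d : ℕ) (x : Fin 2) : (CG1 d x).length = 4 * l0 d + 2 * l1 d := by
  unfold CG1; split_ifs <;> simp <;> omega

theorem length_CG2 (d : ℕ) (x : Fin 2) : (CG2 d x).length = 4 * l0 d + 2 * l1 d := by
  unfold CG2; split_ifs <;> simp <;> omega

theorem count_one_CG1 (d : ℕ) (x : Fin 2) :
    (CG1 d x).count 1 = if x = 0 then 3 * l0 d else l0 d := by
  unfold CG1; split_ifs <;> simp [List.count_append]; omega

theorem count_one_CG2 (d : ℕ) (x : Fin 2) :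
    (CG2 d x).count 1 = if x = 0 then 2 * l0 d else 4 * l0 d := by
  unfold CG2; split_ifs <;> simp [List.count_append] <;> omega

theorem count_one_g (d : ℕ) : (g d).count 1 = 3 * l0 d + 1 := by
  unfold g; simp [List.count_append]; omega

/-- The numbers of `1`s alone separate the coordinate gadgets. -/
theorem le_EDIT_CG1Core (d : ℕ) (x y : Fin 2) (p q : ℕ) :
    l0 d + 2 * l0 d * (x * y : ℕ) ≤ EDIT (run 0 p ++ CG1Core d x ++ run 0 q) (CG2 d y) := by
  have h1 := count_le_add_EDIT (1 : Fin 4) (run 0 p ++ CG1Core d x ++ run 0 q) (CG2 d y)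
  have h2 := count_le_add_EDIT' (1 : Fin 4) (run 0 p ++ CG1Core d x ++ run 0 q) (CG2 d y)
  rw [count_one_CG2] at h1 h2
  fin_cases x <;> fin_cases y <;> simp [CG1Core, List.count_append] at h1 h2 ⊢ <;> omega

/-- If the isolated `1` at the start is to be matched with one of the `1`s of the target, the `n`
`0`s that follow it get lost. -/
theorem le_EDIT_isolated_one (m n p q r : ℕ) (hm : 0 < m) (hn : m + 1 ≤ n) :
    m + 1 ≤ EDIT (run 0 p ++ run 1 1 ++ run 0 n ++ run 1 (3 * m) ++ run 0 q)
      (run 0 r ++ run 1 (4 * m) ++ run 0 r) := by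
  have hE : run 0 p ++ run 1 1 ++ run 0 n ++ run 1 (3 * m) ++ run 0 q =
      (run 0 p ++ run 1 1) ++ (run 0 n ++ (run 1 (3 * m) ++ run 0 q)) := by
    simp only [List.append_assoc]
  rw [hE]
  obtain ⟨y₁, y', hy, h1⟩ := exists_split_right (run 0 p ++ run 1 1)
    (run 0 n ++ (run 1 (3 * m) ++ run 0 q)) (run 0 r ++ run 1 (4 * m) ++ run 0 r)
  obtain ⟨y₂, y₃, rfl, h2⟩ := exists_split_right (run 0 n) (run 1 (3 * m) ++ run 0 q) y'
  have hcount := congrArg (List.count 1) hy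
  have a1 := count_le_add_EDIT (1 : Fin 4) (run 0 p ++ run 1 1) y₁
  have a1' := count_le_add_EDIT' (1 : Fin 4) (run 0 p ++ run 1 1) y₁
  have a2 := count_le_add_EDIT (1 : Fin 4) (run 0 n) y₂
  have a2' := count_le_add_EDIT' (0 : Fin 4) (run 0 n) y₂
  have a3 := count_le_add_EDIT (1 : Fin 4) (run 1 (3 * m) ++ run 0 q) y₃
  have a3' := count_le_add_EDIT' (1 : Fin 4) (run 1 (3 * m) ++ run 0 q) y₃
  simp [List.count_append] at hcount a1 a1' a2 a2' a3 a3'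
  -- If no `1` of the target is left for the first or the last part, counting `1`s suffices.
  by_cases hc1 : y₁.count 1 = 0
  · omega
  by_cases hc3 : y₃.count 1 = 0
  · omega
  -- Both `y₁` and `y₃` contain a `1` of the target, so `y₂` contains `1`s only.
  have hc2 : y₂.count 0 = 0 := by
    rw [List.append_assoc] at hy
    rcases List.append_eq_append_iff.1 hy with ⟨b, -, hb⟩ | ⟨b, hb, -⟩
    · rw [← List.append_assoc] at hb
      rcases List.append_eq_append_iff.1 hb with ⟨e, -, hb'⟩ | ⟨e, he, -⟩
      · have h3 := (eq_run_of_append_eq_run hb'.symm).2.1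
        rw [h3] at hc3
        simp at hc3
      · have h3 := congrArg (List.count 0) he
        simp [List.count_append] at h3
        omega
    · have h3 := congrArg (List.count 1) hb
      simp [List.count_append] at h3
      omega
  omega

theorem l1_half (d : ℕ) : l1 d = 2 * (500000 * (d * d)) := by unfold l1; ring

/-- When `y = 0`, counting `1`s suffices; when `y = 1`, the isolated `1` of `g` matters. -/
theorem le_EDIT_gCore {d : ℕ} (hd : 0 < d) (y : Fin 2) (p q : ℕ) :
    l0 d + 1 ≤ EDIT (run 0 p ++ gCore d ++ run 0 q) (CG2 d y) := by
  have hdd : 0 < d * d := by positivity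
  have hl := l1_half d
  have hl0 : l0 d = 1000 * d := rfl
  by_cases hy : y = 0
  · have h := count_le_add_EDIT' (1 : Fin 4) (run 0 p ++ gCore d ++ run 0 q) (CG2 d y)
    rw [count_one_CG2, if_pos hy] at h
    simp [gCore, List.count_append] at h ⊢
    omega
  · have h := le_EDIT_isolated_one (l0 d) (l1 d / 2 + l0 d) p (l1 d - pad d + q) (l1 d) (by omega)
      (by omega)
    have h4 : run 1 (4 * l0 d) = run 1 (l0 d) ++ run 1 (l0 d) ++ run 1 (l0 d) ++ run 1 (l0 d) := by
      simp only [run_append_run]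
      congr 1
      omega
    rw [h4, run_add 0 (l1 d - pad d)] at h
    simpa only [gCore, CG2, if_neg hy, List.append_assoc] using h

/-! ### The distance of two vector gadgets -/

theorem append_eq_append_cases {α : Type*} {u v x y : List α} (h : u ++ v = x ++ y) :
    (∃ c, u = x ++ c ∧ y = c ++ v) ∨ ∃ c, x = u ++ c ∧ v = c ++ y := by
  rcases List.append_eq_append_iff.1 h with ⟨c, h1, h2⟩ | ⟨c, h1, h2⟩
  · exact .inr ⟨c, h1, h2⟩
  · exact .inl ⟨c, h1, h2⟩

theorem count_zero_add_count_one_le (x : Seq) : x.count 0 + x.count 1 ≤ x.length := by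
  induction x with
  | nil => simp
  | cons s x ih => fin_cases s <;> simp <;> omega

theorem count_one_eq_zero_or_of_prefix {r : ℕ} {y u v : Seq} (h : run 0 r ++ y = u ++ v) :
    u.count 1 = 0 ∨ r ≤ u.count 0 := by
  rcases append_eq_append_cases h with ⟨c, hc, -⟩ | ⟨c, rfl, -⟩
  · left
    rw [(eq_run_of_append_eq_run hc.symm).1]
    simp
  · right
    simp [List.count_append]

theorem count_one_eq_zero_or_of_suffix {r : ℕ} {y u v : Seq} (h : y ++ run 0 r = u ++ v) :
    v.count 1 = 0 ∨ r ≤ v.count 0 := by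
  rcases append_eq_append_cases h with ⟨c, -, rfl⟩ | ⟨c, -, hc⟩
  · right
    simp [List.count_append]
  · left
    rw [(eq_run_of_append_eq_run hc.symm).2.1]
    simp

/-- Deleting what surrounds `y` takes `|u| + |v|` steps. -/
theorem EDIT_append_append_le {α : Type*} (u y v z : List α) :
    EDIT (u ++ y ++ v) z ≤ u.length + EDIT y z + v.length := by
  have h1 := EDIT_append_le (u ++ y) v z []
  have h2 := EDIT_append_le u y [] z
  have h3 := EDIT_nil_right_le u
  have h4 := EDIT_nil_right_le v
  simp only [List.append_nil, List.nil_append] at h1 h2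
  omega

/-- The elementary lower bounds for the distance to a run of `1`s. -/
theorem EDIT_run_one_bounds (x : Seq) (n : ℕ) :
    n ≤ x.length + EDIT x (run 1 n) ∧ x.length ≤ n + EDIT x (run 1 n) ∧
      n ≤ x.count 1 + EDIT x (run 1 n) ∧ x.length ≤ x.count 1 + EDIT x (run 1 n) := by
  have h1 := length_le_add_EDIT x (run 1 n)
  have h2 := length_le_add_EDIT' x (run 1 n)
  have h3 := count_le_add_EDIT (1 : Fin 4) x (run 1 n)
  have h4 := length_sub_count_le' (1 : Fin 4) x (run 1 n)
  simp only [length_run, count_run, if_true] at *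
  omega

/-- Lower bound for the distance of `0^n L 1^n R 0^n` and `1^n D 1^n`, where `n` exceeds the
lengths of `L`, `R` and `D` by far. Each run `1^n` of the target costs `n` if it uses none of the
`1`s of the source, and only the run `1^n` of the source has many of them. So it is too expensive
to let `D` use more than a few symbols of the run `1^n` of the source, and what goes into `D` is
taken from around `L` or from around `R`. In either case `hLD` or `hRD` yields the additional `P +
d`; by `hLp` and `hRs`, giving a `1` of `L` or `R` to one of the runs of the target does not pay,
as it costs at least `r` surrounding `0`s. -/
theorem le_EDIT_vector_gadgets (d P Q N n r : ℕ) (L R D : Seq)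
    (hP : 1000 * d ≤ P) (hQ : 1000 * P ≤ Q) (hN : N = 4 * P + 2 * Q)
    (hn : n = 1000 * Q) (hr : 100 * P ≤ r)
    (hL : L.length = N) (hR : R.length = N) (hD : D.length = N)
    (hL1 : L.count 1 ≤ 3 * P + d) (hR1 : R.count 1 ≤ 3 * P)
    (hLp : ∀ u v, L = u ++ v → u.count 1 = 0 ∨ r ≤ u.count 0)
    (hRs : ∀ u v, R = u ++ v → v.count 1 = 0 ∨ r ≤ v.count 0)
    (hLD : ∀ k j, j ≤ 8 * P → j + (P + d) ≤ EDIT (run 0 k ++ L ++ run 1 j) D)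
    (hRD : ∀ k j, j ≤ 8 * P → j + (P + d) ≤ EDIT (run 1 j ++ R ++ run 0 k) D) :
    2 * n + N + P + d ≤
      EDIT (run 0 n ++ (L ++ (run 1 n ++ (R ++ run 0 n)))) (run 1 n ++ (D ++ run 1 n)) := by
  -- `x₁`, `x` and `x₂` are the parts that go into `1^n`, `D` and `1^n`.
  obtain ⟨x₁, x', e1, hE1⟩ := exists_split_left
    (run 0 n ++ (L ++ (run 1 n ++ (R ++ run 0 n)))) (run 1 n) (D ++ run 1 n)
  obtain ⟨x, x₂, e2, hE2⟩ := exists_split_left x' D (run 1 n)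
  refine le_trans ?_ hE1
  refine le_trans ?_ (Nat.add_le_add_left hE2 _)
  clear hE1 hE2
  obtain ⟨a1, a2, a3, a4⟩ := EDIT_run_one_bounds x₁ n
  obtain ⟨b1, b2, b3, b4⟩ := EDIT_run_one_bounds x₂ n
  have c1 := length_le_add_EDIT x D
  have c2 := length_le_add_EDIT' x D
  have c3 := count_le_add_EDIT (0 : Fin 4) x D
  have c4 := count_le_add_EDIT (1 : Fin 4) x D
  generalize hE₁ : EDIT x₁ (run 1 n) = E₁ at *
  generalize hE₂ : EDIT x₂ (run 1 n) = E₂ at *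
  rcases append_eq_append_cases e1 with ⟨c, h1, h2⟩ | ⟨c, rfl, h1⟩
  · -- The part for `D` starts in the first run of `0`s.
    obtain ⟨k1, k2, k3⟩ := eq_run_of_append_eq_run h1.symm
    have k4 : x₁.count 1 = 0 := by rw [k1]; simp
    rcases append_eq_append_cases (h2.symm.trans e2) with ⟨c', rfl, rfl⟩ | ⟨c', rfl, h3⟩
    · -- It ends there, too.
      simp only [List.length_append, length_run] at *
      omega
    rcases append_eq_append_cases h3 with ⟨c'', rfl, rfl⟩ | ⟨c'', rfl, h4⟩
    · -- It ends in `L`.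
      have h := hLD c.length 0 (by omega)
      have h' := EDIT_append_append_le [] (c ++ c') c'' D
      rw [← k2] at h
      simp [run] at h h'
      simp only [List.length_append, length_run] at *
      omega
    rcases append_eq_append_cases h4 with ⟨c₃, h5, rfl⟩ | ⟨c₃, rfl, h5⟩
    · -- It ends in the run of `1`s.
      obtain ⟨m1, m2, m3⟩ := eq_run_of_append_eq_run h5.symm
      have m4 : c₃.count 1 = c₃.length := by rw [m2]; simp
      have m5 : (run 0 n).count 1 = 0 := by simp
      simp only [List.length_append, length_run, List.count_append] at *
      -- A longer overlap with the run of `1`s leaves too few of them for the other run of `1`s.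
      by_cases hj : c''.length ≤ 8 * P
      · have h := hLD c.length c''.length hj
        rw [← m1, ← k2, List.append_assoc] at h
        omega
      · omega
    · -- It ends behind the run of `1`s.
      have m1 := congrArg (List.count 1) h5
      simp only [List.length_append, length_run, List.count_append, count_run] at *
      simp at m1
      omega
  rcases append_eq_append_cases h1 with ⟨c', h2, h3⟩ | ⟨c', rfl, h2⟩
  · -- The part for `D` starts in `L`.
    have p1 := hLp _ _ h2
    have p2 := count_zero_add_count_one_le c
    subst h2
    rcases append_eq_append_cases (h3.symm.trans e2) with ⟨c'', rfl, rfl⟩ | ⟨c'', rfl, h4⟩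
    · -- It ends in `L`, too.
      have h := hLD 0 0 (by omega)
      have h' := EDIT_append_append_le c x c'' D
      simp [run] at h h'
      have m5 : (run 0 n).count 1 = 0 := by simp
      simp only [List.length_append, length_run, List.count_append] at *
      omega
    rcases append_eq_append_cases h4 with ⟨c₃, h5, rfl⟩ | ⟨c₃, rfl, h5⟩
    · -- It ends in the run of `1`s.
      obtain ⟨m1, m2, m3⟩ := eq_run_of_append_eq_run h5.symm
      have m4 : c₃.count 1 = c₃.length := by rw [m2]; simp
      have m5 : (run 0 n).count 1 = 0 := by simp
      have m6 : (run 0 n).length = n := by simp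
      simp only [List.length_append, List.count_append] at *
      by_cases hj : c''.length ≤ 8 * P
      · have h := hLD 0 c''.length hj
        have h' := EDIT_append_append_le c (c' ++ c'') [] D
        rw [← m1] at h
        simp [run] at h h'
        omega
      · omega
    · -- It ends behind the run of `1`s.
      have m1 := congrArg (List.count 1) h5
      have m5 : (run 0 n).count 1 = 0 := by simp
      simp only [List.length_append, length_run, List.count_append] at *
      omega
  rcases append_eq_append_cases h2 with ⟨c, h3, h4⟩ | ⟨c, rfl, h3⟩
  · -- The part for `D` starts in the run of `1`s.
    obtain ⟨k1, k2, k3⟩ := eq_run_of_append_eq_run h3.symm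
    have k4 : c'.count 1 = c'.length := by rw [k1]; simp
    have k5 : c.count 1 = c.length := by rw [k2]; simp
    have k6 : c.count 0 = 0 := by rw [k2]; simp
    have m5 : (run 0 n).count 1 = 0 := by simp
    have m6 : (run 0 n).length = n := by simp
    rcases append_eq_append_cases (h4.symm.trans e2) with ⟨c'', rfl, rfl⟩ | ⟨c'', rfl, h5⟩
    · -- It ends there, too.
      have m7 := List.count_le_length (a := (1 : Fin 4)) (l := c'')
      have m8 := List.count_le_length (a := (1 : Fin 4)) (l := x)
      simp only [List.length_append, List.count_append] at *
      omega
    rcases append_eq_append_cases h5 with ⟨c₃, h6, rfl⟩ | ⟨c₃, rfl, h6⟩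
    · -- It ends in `R`.
      have p1 := hRs _ _ h6
      have p2 := count_zero_add_count_one_le c₃
      subst h6
      simp only [List.length_append, List.count_append] at *
      by_cases hj : c.length ≤ 8 * P
      · have h := hRD 0 c.length hj
        have h' := EDIT_append_append_le [] (c ++ c'') c₃ D
        rw [← k2] at h
        simp [run] at h h'
        omega
      · omega
    · -- It ends in the last run of `0`s.
      obtain ⟨m1, m2, m3⟩ := eq_run_of_append_eq_run h6.symm
      have m4 : x₂.count 1 = 0 := by rw [m2]; simp
      simp only [List.length_append, List.count_append] at *
      by_cases hj : c.length ≤ 8 * P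
      · have h := hRD c₃.length c.length hj
        rw [← k2, ← m1, List.append_assoc] at h
        omega
      · omega
  have m5 : (run 0 n).count 1 = 0 := by simp
  have m6 : (run 0 n).length = n := by simp
  rcases append_eq_append_cases h3 with ⟨c', h4, h5⟩ | ⟨c', rfl, h4⟩
  · -- The part for `D` starts in `R`.
    subst h4
    rcases append_eq_append_cases (h5.symm.trans e2) with ⟨c'', rfl, rfl⟩ | ⟨c'', rfl, h6⟩
    · -- It ends there, too.
      have p1 := hRs (c ++ x) c'' (by simp)
      have p2 := count_zero_add_count_one_le c''
      have h := hRD 0 0 (by omega)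
      have h' := EDIT_append_append_le c x c'' D
      simp [run] at h h'
      simp only [List.length_append, length_run, List.count_append] at *
      omega
    · -- It ends in the last run of `0`s.
      obtain ⟨k1, k2, k3⟩ := eq_run_of_append_eq_run h6.symm
      have k4 : x₂.count 1 = 0 := by rw [k2]; simp
      have h := hRD c''.length 0 (by omega)
      have h' := EDIT_append_append_le c (c' ++ c'') [] D
      rw [← k1] at h
      simp [run] at h h'
      simp only [List.length_append, length_run, List.count_append] at *
      omega
  · -- The part for `D` lies in the last run of `0`s.
    subst e2
    obtain ⟨k1, k2, k3⟩ := eq_run_of_append_eq_run h4.symm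
    obtain ⟨-, k4, -⟩ := eq_run_of_append_eq_run k2
    have k5 : x₂.count 1 = 0 := by rw [k4]; simp
    simp only [List.length_append, length_run] at *
    omega

theorem concat_eq_flatten_map {d : ℕ} (s : Fin d → Seq) :
    concat s = ((List.finRange d).map s).flatten := by
  rw [concat, List.ofFn_eq_map]

theorem exists_concat_eq_append_left {d : ℕ} (hd : 0 < d) (s : Fin d → Seq) (u : Seq)
    (hs : ∀ i, ∃ y, s i = u ++ y) : ∃ y, concat s = u ++ y := by
  obtain ⟨n, rfl⟩ := Nat.exists_eq_succ_of_ne_zero hd.ne'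
  obtain ⟨y, hy⟩ := hs 0
  exact ⟨_, by rw [concat, List.ofFn_succ, List.flatten_cons, hy, List.append_assoc]⟩

theorem exists_concat_eq_append_right {d : ℕ} (hd : 0 < d) (s : Fin d → Seq) (u : Seq)
    (hs : ∀ i, ∃ y, s i = y ++ u) : ∃ y, concat s = y ++ u := by
  obtain ⟨n, rfl⟩ := Nat.exists_eq_succ_of_ne_zero hd.ne'
  obtain ⟨y, hy⟩ := hs (Fin.last n)
  refine ⟨(List.ofFn fun i => s (Fin.castSucc i)).flatten ++ y, ?_⟩
  rw [concat, List.ofFn_succ', List.concat_eq_append, List.flatten_append, List.append_assoc, ← hy]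
  simp

theorem count_concat_le {d : ℕ} (s : Fin d → Seq) (a : Fin 4) (m : ℕ)
    (h : ∀ i, (s i).count a ≤ m) : (concat s).count a ≤ d * m := by
  rw [concat_eq_flatten_map, List.count_flatten, List.map_map]
  have := List.sum_le_card_nsmul ((List.finRange d).map (List.count a ∘ s)) m (by simpa using h)
  simpa using this

theorem count_concat {d : ℕ} (s : Fin d → Seq) (a : Fin 4) :
    (concat s).count a = ∑ i, (s i).count a := by
  rw [concat_eq_flatten_map, List.count_flatten, List.map_map, Fin.sum_univ_def]
  rfl

theorem two_mul_le_pad (d : ℕ) : 2 * (d * l0 d + d) ≤ pad d := by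
  have h1 : l1 d = 2 * (500000 * (d * d)) := l1_half d
  have h2 : d * l0 d = 1000 * (d * d) := by unfold l0; ring
  have h3 : d ≤ d * d := Nat.le_mul_self d
  unfold pad
  omega

/-- Each of the `d` copies of `g` costs `l₀ + 1`. -/
theorem le_EDIT_concat_g {d : ℕ} (hd : 0 < d) (b : Vec d) (k k' : ℕ) :
    d * l0 d + d ≤ EDIT (run 0 k ++ concat (fun _ : Fin d => g d) ++ run 0 k')
      (concat fun i => CG2 d (b i)) := by
  rw [concat_eq_flatten_map, concat_eq_flatten_map]
  refine le_EDIT_blocks (pad d) (4 * l0 d + 2 * l1 d) _ _ (fun _ => gCore d) _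
    (fun _ => l0 d + 1) (fun _ => g_eq d) (fun _ => length_g hd) (fun _ => length_CG2 d _)
    (fun i p q => le_EDIT_gCore hd (b i) p q) _ ?_ (two_mul_le_pad d) k k'
  simp [mul_add]

theorem le_EDIT_concat_CG1 {d : ℕ} (a b : Vec d) (hab : dot a b ≠ 0) (k k' : ℕ) :
    d * l0 d + d ≤ EDIT (run 0 k ++ concat (fun i => CG1 d (a i)) ++ run 0 k')
      (concat fun i => CG2 d (b i)) := by
  rw [concat_eq_flatten_map, concat_eq_flatten_map]
  refine le_EDIT_blocks (pad d) (4 * l0 d + 2 * l1 d) _ _ (fun i => CG1Core d (a i)) _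
    (fun i => l0 d + 2 * l0 d * (a i * b i : ℕ)) (fun i => CG1_eq d (a i))
    (fun i => length_CG1 d _) (fun i => length_CG2 d _)
    (fun i p q => le_EDIT_CG1Core d (a i) (b i) p q) _ ?_ (two_mul_le_pad d) k k'
  -- The blocks contribute `d l₀ + 2 l₀ (a · b)`, and `2 l₀ ≥ d`.
  rw [← Fin.sum_univ_def, Finset.sum_add_distrib, ← Finset.mul_sum]
  change _ ≤ _ + 2 * l0 d * dot a b
  have h1 : 2 * l0 d * 1 ≤ 2 * l0 d * dot a b := Nat.mul_le_mul_left _ (by omega)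
  have h2 : l0 d = 1000 * d := rfl
  simp
  omega

/-- For vectors that are not orthogonal, no alignment of the vector gadgets costs less than the one
of `D` with `L`. -/
theorem Eu_le_EDIT_AG {d : ℕ} (a b : Vec d) (hab : dot a b ≠ 0) :
    Eu d ≤ EDIT (AG1 a) (AG2 b) := by
  have hd : 0 < d := by
    rcases Nat.eq_zero_or_pos d with rfl | hd
    · simp [dot] at hab
    · exact hd
  -- All the bounds needed are linear in `d`, `P = d l₀` and `Q = d l₁`.
  set Q := d * l1 d with hQ
  set P := d * l0 d with hP
  have hdd : d ≤ d * d := Nat.le_mul_self d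
  have hP' : P = 1000 * (d * d) := by rw [hP]; unfold l0; ring
  have h1 : l1 d = 2 * (500000 * (d * d)) := l1_half d
  have hQ' : Q = 1000 * (1000 * (d * d) * d) := by rw [hQ, h1]; ring
  have hPd : 1000 * (d * d) * 1 ≤ 1000 * (d * d) * d := Nat.mul_le_mul_left _ hd
  have h2 : l2 d = 1000 * Q := by rw [hQ]; unfold l1 l2; ring
  have hl : l d = 4 * P + 2 * Q := by rw [hP, hQ]; unfold l; ring
  have hpad : 2 * (P + d) ≤ pad d := two_mul_le_pad d
  have hp : pad d = l1 d / 2 - 1 := rfl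
  have hCG2 : ∀ x, ∃ y, CG2 d x = run 0 (l1 d) ++ y := fun x => by
    unfold CG2; split_ifs <;> simp only [List.append_assoc] <;> exact ⟨_, rfl⟩
  have hCG2' : ∀ x, ∃ y, CG2 d x = y ++ run 0 (l1 d) := fun x => by
    unfold CG2; split_ifs <;> exact ⟨_, rfl⟩
  have key := le_EDIT_vector_gadgets d P Q (l d) (l2 d) (pad d) (concat fun _ : Fin d => g d)
    (concat fun i => CG1 d (a i)) (concat fun i => CG2 d (b i)) (by omega) (by omega) hl h2
    (by omega) (length_concat _ _ fun _ => length_g hd) (length_concat _ _ fun i => length_CG1 d _)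
    (length_concat _ _ fun i => length_CG2 d _) ?_ ?_ ?_ ?_ ?_ ?_
  · have hEu : Eu d = 2 * l2 d + l d + P + d := by unfold Eu; omega
    rw [hEu]
    simpa only [AG1, AG2, List.append_assoc] using key
  · refine (count_concat_le _ 1 (3 * l0 d + 1) fun _ => (count_one_g d).le).trans ?_
    rw [hP]; ring_nf; rfl
  · refine (count_concat_le _ 1 (3 * l0 d) fun i => ?_).trans ?_
    · rw [count_one_CG1]; split_ifs <;> omega
    · rw [hP]; ring_nf; rfl
  · intro u v h
    obtain ⟨y, hy⟩ := exists_concat_eq_append_left hd (fun _ : Fin d => g d) (run 0 (pad d))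
      fun _ => ⟨gCore d ++ run 0 (pad d), by rw [g_eq, List.append_assoc]⟩
    exact count_one_eq_zero_or_of_prefix (hy.symm.trans h)
  · intro u v h
    obtain ⟨y, hy⟩ := exists_concat_eq_append_right hd (fun i => CG1 d (a i)) (run 0 (pad d))
      fun i => ⟨_, CG1_eq d (a i)⟩
    exact count_one_eq_zero_or_of_suffix (hy.symm.trans h)
  · intro k j hj
    obtain ⟨y, hy⟩ := exists_concat_eq_append_right hd (fun i => CG2 d (b i)) (run 0 (l1 d))
      fun i => hCG2' (b i)
    rw [hy]
    refine add_le_EDIT_append_run _ j _ _ _ (fun i => ?_) (by omega)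
    rw [← hy]
    exact le_EDIT_concat_g hd b k i
  · intro k j hj
    obtain ⟨y, hy⟩ := exists_concat_eq_append_left hd (fun i => CG2 d (b i)) (run 0 (l1 d))
      fun i => hCG2 (b i)
    rw [hy, List.append_assoc]
    refine add_le_EDIT_run_append _ j _ _ _ (fun i => ?_) (by omega)
    rw [← hy, ← List.append_assoc]
    exact le_EDIT_concat_CG1 a b hab i k

/-! ### Upper bounds -/

theorem EDIT_concat_le {d : ℕ} (s s' : Fin d → Seq) :
    EDIT (concat s) (concat s') ≤ ∑ i, EDIT (s i) (s' i) := by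
  rw [concat_eq_flatten_map, concat_eq_flatten_map, Fin.sum_univ_def]
  exact EDIT_flatten_map_le s s' _

theorem EDIT_run_le (s s' : Fin 4) (n : ℕ) : EDIT (run s n) (run s' n) ≤ n := by
  simpa using EDIT_le_max_length (run s n) (run s' n)

theorem EDIT_CG_le (d : ℕ) (x y : Fin 2) (hxy : (x * y : ℕ) = 0) :
    EDIT (CG1 d x) (CG2 d y) ≤ l0 d := by
  have key : ∀ u v : Seq, EDIT (u ++ run 0 (l0 d) ++ v) (u ++ run 1 (l0 d) ++ v) ≤ l0 d :=
    fun u v => (EDIT_append_right_le _ _ _).trans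
      ((EDIT_append_left_le _ _ _).trans (EDIT_run_le _ _ _))
  have key' : ∀ u v : Seq, EDIT (u ++ run 1 (l0 d) ++ v) (u ++ run 0 (l0 d) ++ v) ≤ l0 d :=
    fun u v => (EDIT_append_right_le _ _ _).trans
      ((EDIT_append_left_le _ _ _).trans (EDIT_run_le _ _ _))
  fin_cases x <;> fin_cases y
  · simpa [CG1, CG2] using key' (run 0 (l1 d) ++ run 0 (l0 d))
      (run 1 (l0 d) ++ run 1 (l0 d) ++ run 0 (l1 d))
  · simpa [CG1, CG2] using key (run 0 (l1 d))
      (run 1 (l0 d) ++ run 1 (l0 d) ++ run 1 (l0 d) ++ run 0 (l1 d))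
  · simpa [CG1, CG2] using key (run 0 (l1 d) ++ run 0 (l0 d) ++ run 0 (l0 d))
      (run 1 (l0 d) ++ run 0 (l1 d))
  · simp at hxy

theorem EDIT_g_le {d : ℕ} (hd : 0 < d) (y : Fin 2) : EDIT (g d) (CG2 d y) ≤ l0 d + 1 := by
  have hh := l1_half d
  have hdd : 0 < d * d := by positivity
  have h0 : run 0 (l1 d) = run 0 (l1 d / 2 - 1) ++ run 0 1 ++ run 0 (l1 d / 2) := by
    rw [run_append_run, run_append_run]; congr 1; omega
  -- The isolated `1` is replaced, and so is one more run of length `l₀`.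
  have key : ∀ (u v : Seq) (s s' : Fin 4), EDIT
      (run 0 (l1 d / 2 - 1) ++ (run 1 1 ++ (run 0 (l1 d / 2) ++ (u ++ (run s (l0 d) ++ v)))))
      (run 0 (l1 d / 2 - 1) ++ (run 0 1 ++ (run 0 (l1 d / 2) ++ (u ++ (run s' (l0 d) ++ v)))))
      ≤ l0 d + 1 := fun u v s s' => by
    refine (EDIT_append_left_le _ _ _).trans ((EDIT_append_le _ _ _ _).trans ?_)
    rw [add_comm]
    refine Nat.add_le_add ?_ (EDIT_run_le _ _ _)
    refine (EDIT_append_left_le _ _ _).trans ((EDIT_append_left_le _ _ _).trans ?_)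
    exact (EDIT_append_right_le _ _ _).trans (EDIT_run_le _ _ _)
  obtain rfl | rfl : y = 0 ∨ y = 1 := by omega
  · have h := key (run 0 (l0 d)) (run 1 (l0 d) ++ run 1 (l0 d) ++ run 0 (l1 d)) 1 0
    rw [g, CG2, if_pos rfl]
    nth_rw 2 [h0]
    simpa only [List.append_assoc] using h
  · have h := key [] (run 1 (l0 d) ++ run 1 (l0 d) ++ run 1 (l0 d) ++ run 0 (l1 d)) 0 1
    rw [g, CG2, if_neg (by decide)]
    nth_rw 2 [h0]
    simpa only [List.append_assoc, List.nil_append] using h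

theorem length_concat_g (d : ℕ) : (concat fun _ : Fin d => g d).length = l d :=
  length_concat _ _ fun i => length_g (Fin.pos i)

theorem length_concat_CG1 {d : ℕ} (a : Vec d) : (concat fun i => CG1 d (a i)).length = l d :=
  length_concat _ _ fun _ => length_CG1 d _

/-- Align `V₁ D V₂` with `V₀ R Z₂`. -/
theorem EDIT_AG_le_Es {d : ℕ} (a b : Vec d) (hab : dot a b = 0) :
    EDIT (AG1 a) (AG2 b) ≤ Es d := by
  have h1 := EDIT_concat_le (fun i => CG1 d (a i)) fun i => CG2 d (b i)
  have h2 : ∑ i, EDIT (CG1 d (a i)) (CG2 d (b i)) ≤ ∑ _i : Fin d, l0 d :=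
    Finset.sum_le_sum fun i hi => EDIT_CG_le d _ _ (Finset.sum_eq_zero_iff.1 hab i hi)
  have h3 := EDIT_append_append_le (run 0 (l2 d) ++ concat fun _ : Fin d => g d)
    (run 1 (l2 d) ++ concat (fun i => CG1 d (a i)) ++ run 0 (l2 d)) [] (AG2 b)
  have h4 := EDIT_append_le (run 1 (l2 d) ++ concat fun i => CG1 d (a i)) (run 0 (l2 d))
    (run 1 (l2 d) ++ concat fun i => CG2 d (b i)) (run 1 (l2 d))
  have h5 := EDIT_append_left_le (run 1 (l2 d)) (concat fun i => CG1 d (a i))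
    (concat fun i => CG2 d (b i))
  have h6 := EDIT_run_le 0 1 (l2 d)
  have h7 : AG1 a = (run 0 (l2 d) ++ concat fun _ : Fin d => g d) ++
      (run 1 (l2 d) ++ concat (fun i => CG1 d (a i)) ++ run 0 (l2 d)) ++ [] := by
    simp [AG1]
  rw [← h7] at h3
  simp only [List.length_append, length_run, length_concat_g, List.length_nil] at h3
  simp at h2
  unfold AG2 Es at *
  omega

/-- Align `V₁ D V₂` with `Z₁ L V₀`. -/
theorem EDIT_AG_le_Eu {d : ℕ} (a b : Vec d) : EDIT (AG1 a) (AG2 b) ≤ Eu d := by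
  have h1 := EDIT_concat_le (fun _ : Fin d => g d) fun i => CG2 d (b i)
  have h2 : ∑ i, EDIT (g d) (CG2 d (b i)) ≤ ∑ _i : Fin d, (l0 d + 1) :=
    Finset.sum_le_sum fun i _ => EDIT_g_le (Fin.pos i) _
  have h3 := EDIT_append_append_le []
    (run 0 (l2 d) ++ (concat fun _ : Fin d => g d) ++ run 1 (l2 d))
    (concat (fun i => CG1 d (a i)) ++ run 0 (l2 d)) (AG2 b)
  have h4 := EDIT_append_le (run 0 (l2 d) ++ concat fun _ : Fin d => g d) (run 1 (l2 d))
    (run 1 (l2 d) ++ concat fun i => CG2 d (b i)) (run 1 (l2 d))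
  have h5 := EDIT_append_le (run 0 (l2 d)) (concat fun _ : Fin d => g d) (run 1 (l2 d))
    (concat fun i => CG2 d (b i))
  have h6 := EDIT_run_le 0 1 (l2 d)
  have h7 : AG1 a = [] ++ (run 0 (l2 d) ++ (concat fun _ : Fin d => g d) ++ run 1 (l2 d)) ++
      (concat (fun i => CG1 d (a i)) ++ run 0 (l2 d)) := by
    simp [AG1]
  rw [← h7] at h3
  simp only [List.length_append, length_run, length_concat_CG1, List.length_nil] at h3
  simp [mul_add] at h2
  simp at h4
  unfold AG2 Eu at *
  simp at h3 ⊢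
  omega

theorem EDIT_AG'_le {d : ℕ} (a b : Vec d) : EDIT (AG1' a) (AG2' b) ≤ EDIT (AG1 a) (AG2 b) :=
  (EDIT_append_right_le _ _ _).trans (EDIT_append_left_le _ _ _)

/-! ### Alignments of a vector gadget with several others -/

/-- How a contiguous part `z` of `2^N A 2^N` meets `A`. -/
theorem infix_padded_cases {N : ℕ} {A u z v : Seq}
    (h : run 2 N ++ A ++ run 2 N = u ++ (z ++ v)) :
    (∃ n, z = run 2 n) ∨ ∃ α w β i j, A = α ++ w ++ β ∧ z = run 2 i ++ w ++ run 2 j ∧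
      α <:+ u ∧ β <+: v := by
  -- First the case of a part that starts in `A`.
  have main : ∀ (α A' i : _) (z' : Seq), A = α ++ A' → α <:+ u → z = run 2 i ++ z' →
      A' ++ run 2 N = z' ++ v → ∃ α w β i j, A = α ++ w ++ β ∧ z = run 2 i ++ w ++ run 2 j ∧
      α <:+ u ∧ β <+: v := by
    intro α A' i z' hA hα hz h'
    rcases append_eq_append_cases h' with ⟨c, rfl, rfl⟩ | ⟨c, rfl, hc⟩
    · exact ⟨α, z', c, i, 0, by simp [hA], by simp [hz, run], hα, by simp⟩
    · obtain ⟨h1, -, -⟩ := eq_run_of_append_eq_run hc.symm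
      exact ⟨α, A', [], i, c.length, by simp [hA], by rw [← h1]; simp [hz], hα, by simp⟩
  rw [List.append_assoc] at h
  rcases append_eq_append_cases h with ⟨c, hc, h2⟩ | ⟨c, rfl, h2⟩
  · obtain ⟨-, h3, -⟩ := eq_run_of_append_eq_run hc.symm
    rcases append_eq_append_cases h2 with ⟨c', rfl, h4⟩ | ⟨c', rfl, -⟩
    · exact .inr (main [] A c.length c' rfl (by simp) (by rw [← h3]) h4)
    · exact .inl ⟨_, (eq_run_of_append_eq_run h3).1⟩
  · rcases append_eq_append_cases h2 with ⟨c', rfl, h3⟩ | ⟨c', rfl, h3⟩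
    · exact .inr (main c c' 0 z rfl (by simp) rfl h3.symm)
    · exact .inl ⟨_, (eq_run_of_append_eq_run
        (eq_run_of_append_eq_run h3.symm).2.1).1⟩

/-- A contiguous part `z` of a concatenation of sequences `2^N A 2^N` consists of `2`s only, or
contains `2^N`, or meets at most one of the sequences `A`. -/
theorem infix_blocks_cases {ι : Type*} {N : ℕ} (A : ι → Seq) (is : List ι) (u z v : Seq)
    (h : (is.map fun i => run 2 N ++ A i ++ run 2 N).flatten = u ++ (z ++ v)) :
    (∃ n, z = run 2 n) ∨ N ≤ z.count 2 ∨ ∃ i ∈ is, ∃ α w β p q, A i = α ++ w ++ β ∧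
      z = run 2 p ++ w ++ run 2 q ∧ α <:+ u ∧ β <+: v := by
  induction is generalizing u z with
  | nil =>
    have : z = [] := by
      simp at h
      exact h.2.1
    exact .inl ⟨0, this⟩
  | cons i is ih =>
    simp only [List.map_cons, List.flatten_cons] at h
    rcases append_eq_append_cases h with ⟨c, h1, h2⟩ | ⟨c, rfl, h2⟩
    · rcases append_eq_append_cases h2 with ⟨c', rfl, h3⟩ | ⟨c', rfl, rfl⟩
      · -- `z` starts in the first block and ends in a later one.
        rcases append_eq_append_cases h1 with ⟨e, -, rfl⟩ | ⟨e, -, he⟩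
        · right; left
          simp [List.count_append]
          omega
        · obtain ⟨-, hc, -⟩ := eq_run_of_append_eq_run he.symm
          rcases ih [] c' h3 with ⟨n, rfl⟩ | h4 | ⟨i', hi, α, w, β, p, q, hA, hz, hα, hβ⟩
          · exact .inl ⟨c.length + n, by rw [run_add, ← hc]⟩
          · right; left
            rw [List.count_append]
            omega
          · refine .inr (.inr ⟨i', by simp [hi], α, w, β, c.length + p, q, hA, ?_,
              hα.trans (List.nil_suffix), hβ⟩)
            rw [hz, run_add, ← hc]
            simp only [List.append_assoc]
      · -- `z` lies in the first block.
        rcases infix_padded_cases h1 with h3 | ⟨α, w, β, p, q, hA, hz, hα, hβ⟩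
        · exact .inl h3
        · exact .inr (.inr ⟨i, by simp, α, w, β, p, q, hA, hz, hα,
            hβ.trans (List.prefix_append _ _)⟩)
    · rcases ih c z h2 with h3 | h3 | ⟨i', hi, α, w, β, p, q, hA, hz, hα, hβ⟩
      · exact .inl h3
      · exact .inr (.inl h3)
      · exact .inr (.inr ⟨i', by simp [hi], α, w, β, p, q, hA, hz,
          hα.trans (List.suffix_append _ _), hβ⟩)

theorem count_concat_eq_zero {d : ℕ} {s : Fin d → Seq} {a : Fin 4}
    (h : ∀ i, (s i).count a = 0) : (concat s).count a = 0 := by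
  rw [count_concat]
  exact Finset.sum_eq_zero fun i _ => h i

theorem count_two_AG1 {d : ℕ} (a : Vec d) : (AG1 a).count 2 = 0 := by
  have h1 : (concat fun _ : Fin d => g d).count 2 = 0 :=
    count_concat_eq_zero fun i => by simp [g, List.count_append]
  have h2 : (concat fun i => CG1 d (a i)).count 2 = 0 :=
    count_concat_eq_zero fun i => by unfold CG1; split_ifs <;> simp [List.count_append]
  simp [AG1, List.count_append, h1, h2]

theorem count_two_AG2 {d : ℕ} (b : Vec d) : (AG2 b).count 2 = 0 := by
  have h2 : (concat fun i => CG2 d (b i)).count 2 = 0 :=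
    count_concat_eq_zero fun i => by unfold CG2; split_ifs <;> simp [List.count_append]
  simp [AG2, List.count_append, h2]

theorem count_three_AG2' {d : ℕ} (b : Vec d) : (AG2' b).count 3 = 0 := by
  have h2 : (concat fun i => CG2 d (b i)).count 3 = 0 :=
    count_concat_eq_zero fun i => by unfold CG2; split_ifs <;> simp [List.count_append]
  simp [AG2', AG2, List.count_append, h2]

theorem filter_eq_self_of_count_two {x : Seq} (h : x.count 2 = 0) :
    x.filter (fun s => s != 2) = x := by
  rw [List.filter_eq_self]
  intro s hs
  have : s ≠ 2 := fun h' => List.count_eq_zero.1 h (h' ▸ hs)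
  simpa using this

theorem filter_run_two (n : ℕ) : (run 2 n).filter (fun s => s != 2) = [] := by
  simp [run]

theorem Eu_le_length_AG1 {d : ℕ} (a : Vec d) : Eu d + d * l0 d + d ≤ (AG1 a).length := by
  have h1 : d * l0 d = 1000 * (d * d) := by unfold l0; ring
  have h2 : l1 d = 2 * (500000 * (d * d)) := l1_half d
  have h3 : d ≤ d * d := Nat.le_mul_self d
  have h4 : l2 d = 1000 * d * l1 d := by unfold l1 l2; ring
  rcases Nat.eq_zero_or_pos d with rfl | hd
  · simp [Eu, l, l2]
  have h5 : 1 * l1 d ≤ 1000 * d * l1 d := Nat.mul_le_mul_right _ (by omega)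
  rw [length_AG1]
  unfold Eu
  omega

theorem suffix_of_suffix_append {α : Type*} {a u z : List α} (h : a <:+ u ++ z)
    (hl : a.length ≤ z.length) : a <:+ z :=
  List.suffix_of_suffix_length_le h (List.suffix_append _ _) hl

/-- No contiguous part of a concatenation of gadgets `AG₂'(b)` is closer than `E_u` to `AG₁'(a)` if
no `b` is orthogonal to `a`: the long runs of `2`s make it most favourable to align `AG₁(a)` with a
single `AG₂(b)`. -/
theorem Eu_le_EDIT_AG1'_infix {d : ℕ} (a : Vec d) (bs : List (Vec d))
    (hbs : ∀ b ∈ bs, dot a b ≠ 0) (z : Seq) (hz : z <:+: (bs.map AG2').flatten) :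
    Eu d ≤ EDIT (AG1' a) z := by
  rcases Nat.eq_zero_or_pos d with rfl | hd
  · simp [Eu, l, l2]
  have hlen := Eu_le_length_AG1 a
  have hT : Eu d + (2 * l2 d + l d) ≤ T d := by
    have h1 : (AG1 (f d)).length ≤ t d := le_max_left _ _
    have h2 := Eu_le_length_AG1 (f d)
    have h3 : 2 * t d ≤ T d := Nat.mul_le_mul_right _ (by omega)
    unfold Eu at *
    omega
  by_contra! hlt
  obtain ⟨u, v, huv⟩ := hz
  obtain ⟨z', z₃, rfl, hE'⟩ := exists_split_right (run 2 (T d) ++ AG1 a) (run 2 (T d)) z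
  obtain ⟨z₁, z₂, rfl, hE⟩ := exists_split_right (run 2 (T d)) (AG1 a) z'
  have hsum : EDIT (run 2 (T d)) z₁ + EDIT (AG1 a) z₂ + EDIT (run 2 (T d)) z₃ < Eu d := by
    unfold AG1' at hlt
    omega
  have a1 := length_le_add_EDIT' (run 2 (T d)) z₁
  have a3 := length_le_add_EDIT' (run 2 (T d)) z₃
  have b1 := length_sub_count_le (2 : Fin 4) (run 2 (T d)) z₁
  have b3 := length_sub_count_le (2 : Fin 4) (run 2 (T d)) z₃
  have c2 := count_le_add_EDIT (2 : Fin 4) (AG1 a) z₂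
  have d2 := length_sub_count_le' (2 : Fin 4) (AG1 a) z₂
  rw [count_two_AG1] at c2 d2
  simp only [length_run, count_run, if_true] at *
  have hblocks : (bs.map fun b => run 2 (T d) ++ AG2 b ++ run 2 (T d)).flatten =
      (u ++ z₁) ++ (z₂ ++ (z₃ ++ v)) := by
    rw [← List.append_assoc, ← List.append_assoc, List.append_assoc u, List.append_assoc u]
    exact huv.symm
  rcases infix_blocks_cases _ _ _ _ _ hblocks with
    ⟨n, rfl⟩ | h | ⟨b, hb, α, w, β, p, q, hA, rfl, hα, hβ⟩
  · simp at d2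
    omega
  · omega
  · have hl := congrArg List.length hA
    have h2 := congrArg (List.count 2) hA
    rw [length_AG2] at hl
    rw [count_two_AG2] at h2
    simp only [List.length_append, List.count_append] at hl h2
    have hα' := suffix_of_suffix_append hα (by omega)
    have hβ' := List.prefix_of_prefix_length_le hβ (List.prefix_append z₃ v) (by omega)
    have e1 : α.length + z₁.count 2 ≤ z₁.length := by
      obtain ⟨y, rfl⟩ := hα'
      have := List.count_le_length (a := (2 : Fin 4)) (l := y)
      simp only [List.length_append, List.count_append]
      omega
    have e3 : β.length + z₃.count 2 ≤ z₃.length := by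
      obtain ⟨y, rfl⟩ := hβ'
      have := List.count_le_length (a := (2 : Fin 4)) (l := y)
      simp only [List.length_append, List.count_append]
      omega
    have k1 := EDIT_filter_le (fun s => s != 2) (AG1 a) (run 2 p ++ w ++ run 2 q)
    rw [filter_eq_self_of_count_two (count_two_AG1 a), List.filter_append, List.filter_append,
      filter_run_two, filter_run_two, filter_eq_self_of_count_two (by omega)] at k1
    simp only [List.nil_append, List.append_nil] at k1
    have k2 := EDIT_append_append_le α w β (AG1 a)
    rw [← hA, EDIT_comm w, EDIT_comm (AG2 b)] at k2
    have k3 := Eu_le_EDIT_AG a b (hbs b hb)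
    omega

theorem length_mul_Eu_le_EDIT {d : ℕ} (as bs : List (Vec d))
    (hab : ∀ a ∈ as, ∀ b ∈ bs, dot a b ≠ 0) (z : Seq) (hz : z <:+: (bs.map AG2').flatten) :
    as.length * Eu d ≤ EDIT (P1 as) z := by
  induction as generalizing z with
  | nil => simp
  | cons a as ih =>
    obtain ⟨z₁, z₂, rfl, h⟩ := exists_split_right (AG1' a) (P1 as) z
    have h1 := Eu_le_EDIT_AG1'_infix a bs (hab a (by simp)) z₁
      ((List.prefix_append z₁ z₂).isInfix.trans hz)
    have h2 := ih (fun a ha => hab a (by simp [ha])) z₂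
      ((List.suffix_append z₁ z₂).isInfix.trans hz)
    have h3 : P1 (a :: as) = AG1' a ++ P1 as := by simp [P1]
    rw [h3, List.length_cons, add_mul]
    omega

/-! ### The reduction -/

/-- The list of the vectors whose gadgets make up `P₂`. -/
def vecs {d : ℕ} (as bs : List (Vec d)) : List (Vec d) :=
  List.replicate (as.length - 1) (f d) ++ bs ++ List.replicate (as.length - 1) (f d)

theorem P2_eq {d : ℕ} (as bs : List (Vec d)) : P2 as bs = ((vecs as bs).map AG2').flatten := by
  simp [P2, vecs]

theorem EDIT_P1_le_mul {d : ℕ} (as cs : List (Vec d)) (h : as.length = cs.length) :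
    EDIT (P1 as) (cs.map AG2').flatten ≤ as.length * Eu d := by
  induction as generalizing cs with
  | nil =>
    rw [List.length_nil, eq_comm, List.length_eq_zero_iff] at h
    simp [h, P1]
  | cons a as ih =>
    cases cs with
    | nil => simp at h
    | cons c cs =>
      have h1 := ih cs (by simpa using h)
      have h2 := EDIT_append_le (AG1' a) (P1 as) (AG2' c) (cs.map AG2').flatten
      have h3 : P1 (a :: as) = AG1' a ++ P1 as := by simp [P1]
      have h4 := (EDIT_AG'_le a c).trans (EDIT_AG_le_Eu a c)
      rw [h3, List.length_cons, add_mul, List.map_cons, List.flatten_cons]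
      omega

/-- The runs of `3`s are replaced by what is not aligned with `P₁`. -/
theorem EDIT_P1'_le {d : ℕ} (as bs : List (Vec d)) (u z v : Seq) (h : P2 as bs = u ++ z ++ v) :
    EDIT (P1' as bs) (P2' as bs) ≤ 2 * (P2' as bs).length + EDIT (P1 as) z := by
  have h1 := EDIT_append_le (run 3 (P2' as bs).length ++ P1 as) (run 3 (P2' as bs).length)
    (u ++ z) v
  have h2 := EDIT_append_le (run 3 (P2' as bs).length) (P1 as) u z
  have h3 := EDIT_le_max_length (run 3 (P2' as bs).length) u
  have h4 := EDIT_le_max_length (run 3 (P2' as bs).length) v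
  have h5 := congrArg List.length h
  change (P2' as bs).length = _ at h5
  rw [← h] at h1
  change EDIT (P1' as bs) (P2' as bs) ≤ _ at h1
  simp only [length_run, List.length_append] at h3 h4 h5
  omega

/-- Every `3` costs one step, so transforming `P₁'` into `P₂'` amounts to finding the contiguous
part of `P₂` that is closest to `P₁`. -/
theorem exists_infix_le_EDIT_P1' {d : ℕ} (as bs : List (Vec d)) :
    ∃ z, z <:+: P2 as bs ∧ 2 * (P2' as bs).length + EDIT (P1 as) z ≤
      EDIT (P1' as bs) (P2' as bs) := by
  obtain ⟨z', z₃, h, hE'⟩ := exists_split_right (run 3 (P2' as bs).length ++ P1 as)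
    (run 3 (P2' as bs).length) (P2' as bs)
  obtain ⟨z₁, z₂, rfl, hE⟩ := exists_split_right (run 3 (P2' as bs).length) (P1 as) z'
  refine ⟨z₂, ⟨z₁, z₃, h.symm⟩, ?_⟩
  have h3 : (P2' as bs).count 3 = 0 := by
    rw [P2', P2_eq, List.count_flatten, List.map_map, List.sum_eq_zero_iff]
    simp [count_three_AG2']
  have h4 := congrArg (List.count 3) h
  rw [h3] at h4
  have h5 := count_le_add_EDIT' (3 : Fin 4) (run 3 (P2' as bs).length) z₁
  have h6 := count_le_add_EDIT' (3 : Fin 4) (run 3 (P2' as bs).length) z₃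
  simp only [List.count_append, count_run, if_true] at h4 h5 h6
  unfold P1'
  omega

theorem EDIT_P1'_le_Y {d : ℕ} (as bs : List (Vec d)) (h : as.length ≤ bs.length) :
    EDIT (P1' as bs) (P2' as bs) ≤ 2 * (P2' as bs).length + as.length * Eu d := by
  have hv : as.length ≤ (vecs as bs).length := by simp [vecs]; omega
  refine (EDIT_P1'_le as bs [] (((vecs as bs).take as.length).map AG2').flatten
    (((vecs as bs).drop as.length).map AG2').flatten ?_).trans
      (Nat.add_le_add_left (EDIT_P1_le_mul _ _ (by simpa using hv)) _)
  rw [P2_eq, List.nil_append, ← List.flatten_append, ← List.map_append, List.take_append_drop]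

/-- Align the gadget of `a` with that of `b`. The padding gadgets of `f` leave room for the
remaining gadgets of `P₁`. -/
theorem EDIT_P1'_add_Eu_le {d : ℕ} (as bs : List (Vec d)) (a b : Vec d) (ha : a ∈ as)
    (hb : b ∈ bs) (hab : dot a b = 0) :
    EDIT (P1' as bs) (P2' as bs) + Eu d ≤
      2 * (P2' as bs).length + as.length * Eu d + Es d := by
  obtain ⟨as₁, as₂, rfl⟩ := List.append_of_mem ha
  obtain ⟨bs₁, bs₂, rfl⟩ := List.append_of_mem hb
  set as := as₁ ++ a :: as₂ with has
  set ws₁ := List.replicate (as.length - 1) (f d) ++ bs₁ with hws₁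
  set ws₂ := bs₂ ++ List.replicate (as.length - 1) (f d) with hws₂
  have hlen : as.length = as₁.length + as₂.length + 1 := by simp [has]; omega
  have hl₁ : as₁.length ≤ ws₁.length := by simp [hws₁]; omega
  have hl₂ : as₂.length ≤ ws₂.length := by simp [hws₂]; omega
  set cs₁ := ws₁.drop (ws₁.length - as₁.length) with hcs₁
  set cs₂ := ws₂.take as₂.length with hcs₂
  have hv : vecs as (bs₁ ++ b :: bs₂) = ws₁.take (ws₁.length - as₁.length) ++ cs₁ ++
      b :: (cs₂ ++ ws₂.drop as₂.length) := by
    rw [hcs₁, hcs₂, List.take_append_drop, List.take_append_drop]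
    simp [vecs, hws₁, hws₂]
  have h1 := EDIT_P1'_le as (bs₁ ++ b :: bs₂)
    ((ws₁.take (ws₁.length - as₁.length)).map AG2').flatten
    ((cs₁.map AG2').flatten ++ (AG2' b ++ (cs₂.map AG2').flatten))
    ((ws₂.drop as₂.length).map AG2').flatten (by rw [P2_eq, hv]; simp)
  have h2 := EDIT_append_le (P1 as₁) (AG1' a ++ P1 as₂) (cs₁.map AG2').flatten
    (AG2' b ++ (cs₂.map AG2').flatten)
  have h3 := EDIT_append_le (AG1' a) (P1 as₂) (AG2' b) (cs₂.map AG2').flatten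
  have h4 := EDIT_P1_le_mul as₁ cs₁ (by simp [hcs₁]; omega)
  have h5 := EDIT_P1_le_mul as₂ cs₂ (by simp [hcs₂]; omega)
  have h6 := (EDIT_AG'_le a b).trans (EDIT_AG_le_Es a b hab)
  have h7 : P1 as = P1 as₁ ++ (AG1' a ++ P1 as₂) := by simp [P1, has]
  rw [← h7] at h2
  rw [hlen, add_mul, add_mul]
  omega

theorem mul_Eu_le_EDIT_P1' {d : ℕ} (as bs : List (Vec d)) (h : as.length ≤ bs.length)
    (hab : ∀ a ∈ as, ∀ b ∈ bs, dot a b ≠ 0) :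
    2 * (P2' as bs).length + as.length * Eu d ≤ EDIT (P1' as bs) (P2' as bs) := by
  obtain ⟨z, hz, hE⟩ := exists_infix_le_EDIT_P1' as bs
  rw [P2_eq] at hz
  refine le_trans (Nat.add_le_add_left (length_mul_Eu_le_EDIT as (vecs as bs) ?_ z hz) _) hE
  intro a ha b hb
  by_cases hb' : b ∈ bs
  · exact hab a ha b hb'
  · -- A vector orthogonal to `f` is zero, hence orthogonal to every vector.
    obtain rfl : b = f d := by
      simp [vecs, hb'] at hb
      exact hb.2
    intro hf
    have hbs : 0 < bs.length := (List.length_pos_of_mem ha).trans_le h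
    refine hab a ha bs[0] (List.getElem_mem hbs) (Finset.sum_eq_zero fun i hi => ?_)
    have := Finset.sum_eq_zero_iff.1 hf i hi
    simp [f] at this
    simp [this]

theorem length_eq_card {ι : Type*} {A : Finset ι} {as : List ι} (has : as.Nodup)
    (hasA : ∀ a, a ∈ as ↔ a ∈ A) : as.length = A.card := by
  classical
  rw [← List.toFinset_card_of_nodup has]
  congr 1
  ext a
  simp [hasA]

end EditHardness


theorem mainTheorem2 (d : ℕ) (A B : Finset (EditHardness.Vec d)) (hAB : A.card ≤ B.card)
    (as bs : List (EditHardness.Vec d))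
    (has : as.Nodup) (hasA : ∀ a, a ∈ as ↔ a ∈ A)
    (hbs : bs.Nodup) (hbsB : ∀ b, b ∈ bs ↔ b ∈ B)
    (Y : ℕ)
    (hY : Y = 2 * (EditHardness.P2' as bs).length + A.card * EditHardness.Eu d) :
    ((¬ ∃ a ∈ A, ∃ b ∈ B, EditHardness.dot a b = 0) →
      EditHardness.EDIT (EditHardness.P1' as bs) (EditHardness.P2' as bs) = Y) ∧
    ((∃ a ∈ A, ∃ b ∈ B, EditHardness.dot a b = 0) →
      (EditHardness.EDIT (EditHardness.P1' as bs) (EditHardness.P2' as bs) : ℤ) ≤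
        (Y : ℤ) - ((EditHardness.Eu d : ℤ) - (EditHardness.Es d : ℤ))) := by
  have hA := EditHardness.length_eq_card has hasA
  have hB := EditHardness.length_eq_card hbs hbsB
  subst hY
  rw [← hA, ← hB] at hAB
  rw [← hA]
  constructor
  · intro h
    refine le_antisymm (EditHardness.EDIT_P1'_le_Y as bs hAB)
      (EditHardness.mul_Eu_le_EDIT_P1' as bs hAB fun a ha b hb hab => h ?_)
    exact ⟨a, (hasA a).1 ha, b, (hbsB b).1 hb, hab⟩
  · rintro ⟨a, ha, b, hb, hab⟩
    have h := EditHardness.EDIT_P1'_add_Eu_le as bs a b ((hasA a).2 ha) ((hbsB b).2 hb) hab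
    push_cast
    zify at h
    linarith
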